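/- Let $N\ge 1$ be an integer. For real numbers $a_1,\dots,a_N$ and $\mu$, let $$p(\lambda)=\lambda^{N}-\mu\,q(\lambda),\qquad q(\lambda)=a_1\lambda^{N-1}+a_2\lambda^{N-2}+\cdots+a_{N-1}\lambda+a_N$$ (this is the case $T=1$ of the polynomial $\lambda^{(N-1)T+1}-\mu\,q(\lambda)^T$). Let $\tilde\mu$ be a real number with $$\tilde\mu<-\cot^2\frac{\pi}{2(N+1)}.$$ Then there is no choice of real numbers $a_1,\dots,a_N$ with $a_1+\cdots+a_N=1$ such that, for every $\mu\in(\tilde\mu,1)$, the polynomial $p(\lambda)$ is Schur stable, i.e. all of its complex roots lie in the open unit disc $\{z\in\mathbb{C}:|z|<1\}$. -/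

import Mathlib

namespace DFC

open Polynomial

/-- The polynomial `q(λ) = a₁ λ^(N-1) + ⋯ + a_{N-1} λ + a_N`. The coefficient `a_j`
(`1 ≤ j ≤ N`) is `a i` with `i = j - 1`. -/
noncomputable def q (N : ℕ) (a : Fin N → ℝ) : ℝ[X] :=
  ∑ i : Fin N, C (a i) * X ^ (N - 1 - (i : ℕ))

/-- The polynomial `p(λ) = λ^((N-1)T+1) - μ q(λ)^T` associated to a `T`-cycle with multiplier
`μ` and to the coefficients `a₁, …, a_N` of the delayed feedback control. -/
noncomputable def p (T N : ℕ) (a : Fin N → ℝ) (μ : ℝ) : ℝ[X] :=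
  X ^ ((N - 1) * T + 1) - C μ * q N a ^ T

/-- Schur stability: every complex root lies in the open unit disc. -/
def SchurStable (f : ℝ[X]) : Prop :=
  ∀ z : ℂ, aeval z f = 0 → ‖z‖ < 1

end DFC

namespace DFC

open Polynomial Filter Topology

/-! Put F(w) = a₁ w + ⋯ + a_N w^N. For w on the unit circle, w⁻¹ is a root of p exactly when μ F(w)
= 1. Stability for all μ in (μt, 1) therefore forces every real value of F on the circle into [-ρ,
1], where ρ = -1/μt. By `one_le_cot_sq_mul` this gives 1 ≤ ρ cot² θ with θ = π/(2(N+1)),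
contradicting μt < -cot² θ.

If F is typically real, i.e. Im F(e^{it}) sin t ≥ 0, then averaging cot(t/2) Im F and tan(t/2) Im F
over the roots of z^(N+1) = -1 yields F(1) and -F(-1). At these nodes the ratio cot²(t/2) is at most
cot² θ, whence `eval_one_nonneg_and_le_of_typically_real`.

The general case reduces to this one: `exists_reduce` cancels the sign changes of Im F in pairs,
keeping F(1) ≥ 1 and F(-1) ≥ -ρ. -/

/-- The value of a real polynomial at the point `exp (i t)` of the unit circle. -/
noncomputable def onCircle (F : ℝ[X]) (t : ℝ) : ℂ :=
  aeval (Complex.exp (t * Complex.I)) F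

lemma continuous_onCircle (F : ℝ[X]) : Continuous (onCircle F) := by
  unfold onCircle
  fun_prop

lemma onCircle_zero (F : ℝ[X]) : onCircle F 0 = (F.eval 1 : ℝ) := by
  simp [onCircle, aeval_def, eval₂_at_one]

lemma onCircle_pi (F : ℝ[X]) : onCircle F Real.pi = (F.eval (-1) : ℝ) := by
  have h := eval₂_at_apply (p := F) (algebraMap ℝ ℂ) (-1)
  simp only [onCircle, Complex.exp_pi_mul_I, aeval_def]
  simpa using h

/-- A continuous function that is nonnegative wherever `h ≠ 0` is nonnegative everywhere, if `h`
has nonzero derivative at its zeros. -/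
lemma nonneg_of_mul_sq_nonneg {f h h' : ℝ → ℝ} (hf : Continuous f)
    (hh : ∀ t, HasDerivAt h (h' t) t) (hne : ∀ t, h t = 0 → h' t ≠ 0)
    (hnn : ∀ t, 0 ≤ f t * h t ^ 2) (t : ℝ) : 0 ≤ f t := by
  have key : ∀ t, h t ≠ 0 → 0 ≤ f t := fun t ht =>
    nonneg_of_mul_nonneg_left (hnn t) (by positivity)
  by_cases ht : h t = 0
  · have hev := (hh t).eventually_ne (c := 0) (hne t ht)
    exact ge_of_tendsto (hf.continuousAt.tendsto.mono_left nhdsWithin_le_nhds)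
      (hev.mono fun s hs => key s hs)
  · exact key t ht

/-! ### Averaging over the roots of `z ^ M = -1` -/

/-- The arguments of the solutions of `z ^ M = -1`. -/
noncomputable def node (M k : ℕ) : ℝ := (2 * k + 1) * (Real.pi / M)

/-- The powers z^j with 0 < j < M sum to zero over the nodes, so only the constant term survives. -/
lemma sum_onCircle_node {M : ℕ} (hM : 0 < M) {F : ℝ[X]} (hF : F.natDegree < M) :
    ∑ k ∈ Finset.range M, onCircle F (node M k) = (M * F.coeff 0 : ℝ) := by
  have hM' : (M : ℂ) ≠ 0 := by exact_mod_cast hM.ne'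
  set ω : ℂ := Complex.exp (2 * Real.pi * Complex.I / M) with hω
  set ζ : ℂ := Complex.exp (Real.pi * Complex.I / M) with hζ
  have hprim : IsPrimitiveRoot ω M := Complex.isPrimitiveRoot_exp M hM.ne'
  have hpt : ∀ k : ℕ, Complex.exp ((node M k : ℝ) * Complex.I) = ζ * ω ^ k := by
    intro k
    rw [hζ, hω, ← Complex.exp_nat_mul, ← Complex.exp_add]
    congr 1
    simp only [node]
    push_cast
    field_simp
    ring
  have hpow : ∀ j ∈ Finset.range M, j ≠ 0 →
      ∑ k ∈ Finset.range M, (F.coeff j : ℝ) • (ζ * ω ^ k) ^ j = 0 := by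
    intro j hj hj0
    have h1 : (ω ^ j) ≠ 1 := hprim.pow_ne_one_of_pos_of_lt hj0 (Finset.mem_range.1 hj)
    have h2 : ∑ k ∈ Finset.range M, (ω ^ j) ^ k = 0 := by
      have h3 := geom_sum_mul (ω ^ j) M
      rw [← pow_mul, mul_comm j M, pow_mul, hprim.pow_eq_one, one_pow, sub_self] at h3
      exact (mul_eq_zero.1 h3).resolve_right (sub_ne_zero.2 h1)
    rw [← Finset.smul_sum]
    have h4 : ∀ k, (ζ * ω ^ k) ^ j = ζ ^ j * (ω ^ j) ^ k := fun k => by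
      rw [mul_pow, ← pow_mul, ← pow_mul, mul_comm k j]
    simp only [h4, ← Finset.mul_sum, h2, mul_zero, smul_zero]
  simp only [onCircle, hpt, aeval_eq_sum_range' hF]
  rw [Finset.sum_comm, Finset.sum_eq_single_of_mem 0 (Finset.mem_range.2 hM) hpow]
  simp

lemma sum_re_onCircle_node {M : ℕ} (hM : 0 < M) {F : ℝ[X]} (hF : F.natDegree < M) :
    ∑ k ∈ Finset.range M, (onCircle F (node M k)).re = M * F.coeff 0 := by
  rw [← Complex.re_sum, sum_onCircle_node hM hF, Complex.ofReal_re]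

/-- The half-nodes are odd multiples of θ = π/(2M) and lie in [θ, π - θ]. -/
lemma sin_le_sin_half_node {M k : ℕ} (hk : k < M) :
    Real.sin (Real.pi / (2 * M)) ≤ Real.sin (node M k / 2) := by
  have hM : (0 : ℝ) < M := by exact_mod_cast (Nat.zero_le k).trans_lt hk
  have hk' : (k : ℝ) + 1 ≤ M := by exact_mod_cast hk
  set θ := Real.pi / (2 * M) with hθ
  have hθM : θ * (2 * M) = Real.pi := by rw [hθ]; field_simp
  have hθ0 : 0 < θ := by rw [hθ]; positivity
  have hnode : node M k / 2 = (2 * k + 1) * θ := by rw [node, hθ]; field_simp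
  rw [hnode]
  have hk0 : (0 : ℝ) ≤ k := Nat.cast_nonneg k
  have h1 : θ ≤ (2 * k + 1) * θ := by nlinarith
  have h2 : (2 * k + 1) * θ ≤ Real.pi - θ := by nlinarith
  rcases le_total ((2 * k + 1) * θ) (Real.pi / 2) with h | h
  · exact Real.sin_le_sin_of_le_of_le_pi_div_two (by linarith) h h1
  · rw [← Real.sin_pi_sub ((2 * k + 1) * θ)]
    exact Real.sin_le_sin_of_le_of_le_pi_div_two (by linarith) (by linarith) (by linarith)

/-! ### Typically real polynomials -/

/-- P is the quotient of F - F(b) by X - b. Its constant term carries F(b), so averaging P for b =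
±1 recovers F(±1). -/
lemma exists_onCircle_sub (F : ℝ[X]) {N : ℕ} (hF : F.natDegree ≤ N) (h0 : F.coeff 0 = 0) (b : ℝ) :
    ∃ P : ℝ[X], P.natDegree ≤ N ∧ b * P.coeff 0 = F.eval b ∧
      ∀ t, onCircle F t - (F.eval b : ℝ) = (Complex.exp (t * Complex.I) - b) * onCircle P t := by
  have hmul : (X - C b) * ((F - C (F.eval b)) /ₘ (X - C b)) = F - C (F.eval b) :=
    mul_divByMonic_eq_iff_isRoot.2 (by simp)
  refine ⟨(F - C (F.eval b)) /ₘ (X - C b), ?_, ?_, fun t => ?_⟩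
  · rw [natDegree_divByMonic _ (monic_X_sub_C b), natDegree_sub_C]
    omega
  · have := congrArg (fun p => coeff p 0) hmul
    simp [mul_coeff_zero, h0] at this
    linarith
  · have := congrArg (aeval (Complex.exp (t * Complex.I))) hmul
    simp at this
    simp only [onCircle]
    exact this.symm

lemma exp_mul_I_half (t : ℝ) : Complex.exp (t * Complex.I) =
    ⟨1 - 2 * Real.sin (t / 2) ^ 2, 2 * Real.sin (t / 2) * Real.cos (t / 2)⟩ := by
  apply Complex.ext
  · have h := Real.cos_two_mul (t / 2)
    rw [mul_div_cancel₀ t two_ne_zero] at h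
    rw [Complex.exp_ofReal_mul_I_re, h]
    linear_combination 2 * Real.sin_sq_add_cos_sq (t / 2)
  · rw [Complex.exp_ofReal_mul_I_im, ← Real.sin_two_mul]
    ring_nf

theorem eval_one_nonneg_and_le_of_typically_real {N : ℕ} {F : ℝ[X]} (hF : F.natDegree ≤ N)
    (h0 : F.coeff 0 = 0) (hS : ∀ t, 0 ≤ (onCircle F t).im * Real.sin t) :
    0 ≤ F.eval 1 ∧
      F.eval 1 ≤ Real.cot (Real.pi / (2 * ((N : ℝ) + 1))) ^ 2 * -F.eval (-1) := by
  obtain ⟨P, hPdeg, hP0, hP⟩ := exists_onCircle_sub F hF h0 1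
  obtain ⟨Q, hQdeg, hQ0, hQ⟩ := exists_onCircle_sub F hF h0 (-1)
  -- With z = e^{it}, (z+1)/(z-1) = -i cot(t/2) and (1-z)/(1+z) = -i tan(t/2). Hence E and D are
  -- cot(t/2) Im F and tan(t/2) Im F, in a form that has no poles and can be averaged.
  set E : ℝ → ℝ := fun t => 2 * (onCircle P t).re + (onCircle F t).re - F.eval 1 with hE
  set D : ℝ → ℝ := fun t => 2 * (onCircle Q t).re - (onCircle F t).re + F.eval (-1) with hD
  have hM : 0 < N + 1 := N.succ_pos
  have hM' : (0 : ℝ) < (N + 1 : ℕ) := by exact_mod_cast hM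
  have sumE : ∑ k ∈ Finset.range (N + 1), E (node (N + 1) k) = (N + 1 : ℕ) * F.eval 1 := by
    simp only [hE, Finset.sum_sub_distrib, Finset.sum_add_distrib, ← Finset.mul_sum,
      sum_re_onCircle_node hM (Nat.lt_succ_of_le hPdeg),
      sum_re_onCircle_node hM (Nat.lt_succ_of_le hF), h0, Finset.sum_const, Finset.card_range,
      nsmul_eq_mul]
    rw [← hP0]; ring
  have sumD : ∑ k ∈ Finset.range (N + 1), D (node (N + 1) k) = (N + 1 : ℕ) * -F.eval (-1) := by
    simp only [hD, Finset.sum_sub_distrib, Finset.sum_add_distrib, ← Finset.mul_sum,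
      sum_re_onCircle_node hM (Nat.lt_succ_of_le hQdeg),
      sum_re_onCircle_node hM (Nat.lt_succ_of_le hF), h0, Finset.sum_const, Finset.card_range,
      nsmul_eq_mul]
    rw [← hQ0]; ring
  have hEs : ∀ t, E t * Real.sin (t / 2) = Real.cos (t / 2) * (onCircle F t).im := by
    intro t
    have h := hP t
    rw [exp_mul_I_half] at h
    have hre := congrArg Complex.re h
    have him := congrArg Complex.im h
    simp at hre him
    have hsc := Real.sin_sq_add_cos_sq (t / 2)
    simp only [hE]
    generalize Real.sin (t / 2) = σ at *
    generalize Real.cos (t / 2) = κ at *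
    linear_combination σ * hre - κ * him - 2 * σ * (onCircle P t).re * hsc
  have hDs : ∀ t, D t * Real.cos (t / 2) = Real.sin (t / 2) * (onCircle F t).im := by
    intro t
    have h := hQ t
    rw [exp_mul_I_half] at h
    have hre := congrArg Complex.re h
    have him := congrArg Complex.im h
    simp at hre him
    have hsc := Real.sin_sq_add_cos_sq (t / 2)
    simp only [hD]
    generalize Real.sin (t / 2) = σ at *
    generalize Real.cos (t / 2) = κ at *
    linear_combination -κ * hre - σ * him + 2 * σ * (onCircle Q t).im * hsc
  have hW : ∀ t, 0 ≤ (onCircle F t).im * (Real.sin (t / 2) * Real.cos (t / 2)) := by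
    intro t
    have h1 : Real.sin t = 2 * Real.sin (t / 2) * Real.cos (t / 2) := by
      rw [← Real.sin_two_mul]; ring_nf
    have := hS t
    rw [h1] at this
    linarith
  have hDnn : ∀ t, 0 ≤ D t := by
    refine nonneg_of_mul_sq_nonneg (h := fun t => Real.cos (t / 2))
      (h' := fun t => -Real.sin (t / 2) * (1 / 2)) ?_ (fun t => ?_) (fun t ht => ?_) (fun t => ?_)
    · have := continuous_onCircle F
      have := continuous_onCircle Q
      simp only [hD]
      fun_prop
    · exact ((hasDerivAt_id t).div_const 2).cos
    · have hsc := Real.sin_sq_add_cos_sq (t / 2)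
      intro h
      have hs : Real.sin (t / 2) = 0 := by linarith
      rw [ht, hs] at hsc
      norm_num at hsc
    · have := hW t
      have h2 : D t * Real.cos (t / 2) ^ 2 =
          (onCircle F t).im * (Real.sin (t / 2) * Real.cos (t / 2)) := by
        linear_combination Real.cos (t / 2) * hDs t
      simpa only [h2] using this
  set θ := Real.pi / (2 * ((N : ℝ) + 1)) with hθ
  have hθ0 : 0 < θ := by rw [hθ]; positivity
  have hθpi : θ < Real.pi := by
    rw [hθ, div_lt_iff₀ (by positivity)]
    have : (0 : ℝ) ≤ N := Nat.cast_nonneg N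
    nlinarith [Real.pi_pos]
  have hsθ : 0 < Real.sin θ := Real.sin_pos_of_pos_of_lt_pi hθ0 hθpi
  have hnode : ∀ k ∈ Finset.range (N + 1), Real.sin θ ≤ Real.sin (node (N + 1) k / 2) := by
    intro k hk
    have := sin_le_sin_half_node (Finset.mem_range.1 hk)
    push_cast at this
    exact this
  have hEnn : ∀ k ∈ Finset.range (N + 1), 0 ≤ E (node (N + 1) k) := by
    intro k hk
    have hs : 0 < Real.sin (node (N + 1) k / 2) := hsθ.trans_le (hnode k hk)
    refine nonneg_of_mul_nonneg_left (b := Real.sin (node (N + 1) k / 2) ^ 2) ?_ (by positivity)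
    have := hW (node (N + 1) k)
    nlinarith [hEs (node (N + 1) k)]
  have hED : ∀ k ∈ Finset.range (N + 1),
      E (node (N + 1) k) ≤ Real.cot θ ^ 2 * D (node (N + 1) k) := by
    intro k hk
    have hle := hnode k hk
    generalize node (N + 1) k = t at *
    have hs : 0 < Real.sin (t / 2) := hsθ.trans_le hle
    have hsq : Real.sin θ ^ 2 ≤ Real.sin (t / 2) ^ 2 := by gcongr
    rw [Real.cot_eq_cos_div_sin, div_pow, div_mul_eq_mul_div, le_div_iff₀ (by positivity)]
    have hd := hDnn t
    have he := hEs t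
    have hdd := hDs t
    have hw := hW t
    have h1 := Real.sin_sq_add_cos_sq (t / 2)
    have h2 := Real.sin_sq_add_cos_sq θ
    by_cases hc : Real.cos (t / 2) = 0
    · have : E t = 0 := by
        rw [hc, zero_mul] at he
        exact (mul_eq_zero.1 he).resolve_right hs.ne'
      rw [this, zero_mul]
      positivity
    · have hpos : 0 < Real.sin (t / 2) ^ 2 * Real.cos (t / 2) ^ 2 := by positivity
      -- Clearing denominators leaves sin² θ cos²(t/2) ≤ cos² θ sin²(t/2), times a nonnegative
      -- factor.
      refine le_of_mul_le_mul_right ?_ hpos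
      have e1 : E t * Real.sin θ ^ 2 * (Real.sin (t / 2) ^ 2 * Real.cos (t / 2) ^ 2) =
          (onCircle F t).im * (Real.sin (t / 2) * Real.cos (t / 2)) *
            (Real.sin θ ^ 2 * Real.cos (t / 2) ^ 2) := by
        linear_combination Real.sin θ ^ 2 * Real.sin (t / 2) * Real.cos (t / 2) ^ 2 * he
      have e2 : Real.cos θ ^ 2 * D t * (Real.sin (t / 2) ^ 2 * Real.cos (t / 2) ^ 2) =
          (onCircle F t).im * (Real.sin (t / 2) * Real.cos (t / 2)) *
            (Real.cos θ ^ 2 * Real.sin (t / 2) ^ 2) := by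
        linear_combination Real.cos θ ^ 2 * Real.sin (t / 2) ^ 2 * Real.cos (t / 2) * hdd
      rw [e1, e2]
      refine mul_le_mul_of_nonneg_left ?_ hw
      nlinarith
  constructor
  · have := Finset.sum_nonneg hEnn
    rw [sumE] at this
    exact nonneg_of_mul_nonneg_right this hM'
  · have := Finset.sum_le_sum hED
    rw [← Finset.mul_sum, sumE, sumD] at this
    refine le_of_mul_le_mul_left ?_ hM'
    linarith

/-! ### Moving the sign changes of the imaginary part -/

/-- If `F` is real, with value `r`, at the points of the unit circle with abscissa `c`, then
`r + (F - r) (cos t - d) / (cos t - c)` is again the restriction to the circle of a polynomial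
with the same degree bound and zero constant term. -/
lemma exists_move_zero {N : ℕ} {F : ℝ[X]} (hF : F.natDegree ≤ N) (h0 : F.coeff 0 = 0)
    {c r : ℝ} (hc : -1 < c) (hc' : c < 1) (hr : onCircle F (Real.arccos c) = r) (d : ℝ) :
    ∃ G : ℝ[X], G.natDegree ≤ N ∧ G.coeff 0 = 0 ∧ ∀ t : ℝ,
      (onCircle G t - r) * ((Real.cos t - c : ℝ) : ℂ) =
        (onCircle F t - r) * ((Real.cos t - d : ℝ) : ℂ) := by
  set z : ℂ := Complex.exp ((Real.arccos c : ℝ) * Complex.I) with hz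
  have hzre : z.re = c := by
    rw [hz, Complex.exp_ofReal_mul_I_re, Real.cos_arccos hc.le hc'.le]
  have hzim : z.im ≠ 0 := by
    rw [hz, Complex.exp_ofReal_mul_I_im]
    exact (Real.sin_pos_of_pos_of_lt_pi (Real.arccos_pos.2 hc') (Real.arccos_lt_pi.2 hc)).ne'
  have hroot : aeval z (F - C r) = 0 := by
    simp only [onCircle] at hr
    simp [hz, hr]
  obtain ⟨Q, hQ⟩ := quadratic_dvd_of_aeval_eq_zero_im_ne_zero _ hroot hzim
  rw [hzre, show ‖z‖ = 1 from Complex.norm_exp_ofReal_mul_I _] at hQ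
  -- On the circle X² - 2cX + 1 equals 2z(cos t - c), so F - r = 2zQ(cos t - c); adding 2(c - d)zQ
  -- replaces c by d.
  refine ⟨F + C (2 * (c - d)) * (X * Q), ?_, ?_, fun t => ?_⟩
  · by_cases hQ0 : Q = 0
    · simpa [hQ0] using hF
    have hmonic : (X ^ 2 - C (2 * c) * X + C (1 ^ 2) : ℝ[X]).natDegree = 2 := by
      compute_degree!
    have hne : (X ^ 2 - C (2 * c) * X + C (1 ^ 2) : ℝ[X]) ≠ 0 := by
      intro h
      rw [h] at hmonic
      simp at hmonic
    have hdeg := congrArg natDegree hQ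
    rw [natDegree_sub_C, natDegree_mul hne hQ0, hmonic] at hdeg
    refine (natDegree_add_le _ _).trans (max_le hF ?_)
    refine (natDegree_C_mul_le _ _).trans ?_
    rw [natDegree_X_mul hQ0]
    omega
  · simp [h0, mul_coeff_zero]
  · have h := congrArg (aeval (Complex.exp (t * Complex.I))) hQ
    simp only [map_sub, map_mul, map_add, map_pow, aeval_X, aeval_C, Complex.coe_algebraMap] at h
    have hne := Complex.exp_ne_zero (t * Complex.I)
    have hcos : 2 * Complex.exp (t * Complex.I) * (Real.cos t : ℂ) =
        Complex.exp (t * Complex.I) ^ 2 + 1 := by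
      rw [Complex.ofReal_cos, Complex.cos, neg_mul, Complex.exp_neg]
      field_simp
    simp only [onCircle, map_add, map_mul, aeval_X, aeval_C, Complex.coe_algebraMap]
    generalize Complex.exp (t * Complex.I) = w at *
    push_cast at h hcos ⊢
    linear_combination (d - c : ℂ) * h + (c - d : ℂ) * aeval w Q * hcos

/-- Moving the zero at `c` to a zero at `d`, in terms of the sign of the imaginary part. -/
lemma im_mul_nonneg_of_move {F G : ℝ[X]} {c d r ε : ℝ} (hc : -1 < c) (hc' : c < 1)
    (hG : ∀ t : ℝ, (onCircle G t - r) * ((Real.cos t - c : ℝ) : ℂ) =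
        (onCircle F t - r) * ((Real.cos t - d : ℝ) : ℂ))
    {w : ℝ → ℝ} (hw : Continuous w)
    (hF : ∀ t, 0 ≤ ε * ((onCircle F t).im * Real.sin t *
      ((Real.cos t - c) * ((Real.cos t - d) * w t)))) (t : ℝ) :
    0 ≤ ε * ((onCircle G t).im * Real.sin t * w t) := by
  refine nonneg_of_mul_sq_nonneg (f := fun t => ε * ((onCircle G t).im * Real.sin t * w t))
    (h := fun t => Real.cos t - c) (h' := fun t => -Real.sin t) ?_
    (fun t => (Real.hasDerivAt_cos t).sub_const c) (fun t ht => ?_) (fun t => ?_) t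
  · have := continuous_onCircle G
    fun_prop
  · have hsc := Real.sin_sq_add_cos_sq t
    intro h
    have hs : Real.sin t = 0 := by linarith
    have hcc : Real.cos t = c := by linarith
    rw [hs, hcc] at hsc
    nlinarith
  · have him := congrArg Complex.im (hG t)
    rw [Complex.im_mul_ofReal, Complex.im_mul_ofReal] at him
    simp only [Complex.sub_im, Complex.ofReal_im, sub_zero] at him
    have := hF t
    calc 0 ≤ _ := this
      _ = _ := by linear_combination (-ε * Real.sin t * w t * (Real.cos t - c)) * him

/-- A real value at a point of the circle moves to a convex combination. -/
lemma onCircle_move_eq {F G : ℝ[X]} {c d r v t : ℝ}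
    (hG : (onCircle G t - r) * ((Real.cos t - c : ℝ) : ℂ) =
        (onCircle F t - r) * ((Real.cos t - d : ℝ) : ℂ))
    (hv : onCircle F t = v) (hne : Real.cos t ≠ c) :
    onCircle G t = (r + (v - r) * ((Real.cos t - d) / (Real.cos t - c)) : ℝ) := by
  have hne' : ((Real.cos t - c : ℝ) : ℂ) ≠ 0 := by
    exact_mod_cast sub_ne_zero.2 hne
  rw [hv] at hG
  have := eq_div_of_mul_eq hne' hG
  rw [sub_eq_iff_eq_add] at this
  rw [this]
  push_cast
  ring

lemma convex_bounds {l u r v κ : ℝ} (hr : l ≤ r ∧ r ≤ u) (hv : l ≤ v) (hκ : 0 ≤ κ) (hκ' : κ ≤ 1) :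
    l ≤ r + (v - r) * κ ∧ (v ≤ u → r + (v - r) * κ ≤ u) := by
  obtain ⟨h1, h2⟩ := hr
  refine ⟨by nlinarith, fun h => by nlinarith⟩

/-- One reduction: the largest sign change `c` of the imaginary part is moved onto `d`. -/
lemma exists_reduce_step {N : ℕ} {ρ ε : ℝ} {m : Multiset ℝ} {F : ℝ[X]} {c d : ℝ}
    (hF : F.natDegree ≤ N) (h0 : F.coeff 0 = 0) (h1 : 1 ≤ F.eval 1) (hneg : -ρ ≤ F.eval (-1))
    (hd : -1 ≤ d) (hdc : d < c) (hc' : c < 1)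
    (hc : ∃ r : ℝ, onCircle F (Real.arccos c) = r ∧ -ρ ≤ r ∧ r ≤ 1)
    (hm : ∀ b ∈ m, -1 < b ∧ b ≤ d ∧ ∃ r : ℝ, onCircle F (Real.arccos b) = r ∧ -ρ ≤ r ∧ r ≤ 1)
    (hS : ∀ t, 0 ≤ ε * ((onCircle F t).im * Real.sin t *
      ((Real.cos t - c) * ((Real.cos t - d) * (m.map fun b => Real.cos t - b).prod)))) :
    ∃ G : ℝ[X], G.natDegree ≤ N ∧ G.coeff 0 = 0 ∧ 1 ≤ G.eval 1 ∧ -ρ ≤ G.eval (-1) ∧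
      (∀ b ∈ m, ∃ r : ℝ, onCircle G (Real.arccos b) = r ∧ -ρ ≤ r ∧ r ≤ 1) ∧
      ∀ t, 0 ≤ ε * ((onCircle G t).im * Real.sin t * (m.map fun b => Real.cos t - b).prod) := by
  obtain ⟨r, hr, hrl, hru⟩ := hc
  have hc1 : -1 < c := by linarith
  obtain ⟨G, hGdeg, hG0, hG⟩ := exists_move_zero hF h0 hc1 hc' hr d
  refine ⟨G, hGdeg, hG0, ?_, ?_, fun b hb => ?_, ?_⟩
  · have h := onCircle_move_eq (hG 0) (onCircle_zero F) (by rw [Real.cos_zero]; exact hc'.ne')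
    rw [onCircle_zero, Complex.ofReal_inj, Real.cos_zero] at h
    -- Since r ≤ 1 ≤ F(1), stretching F(1) - r by a factor at least 1 cannot lower the value at 1.
    have hκ : 1 ≤ (1 - d) / (1 - c) := by rw [le_div_iff₀] <;> linarith
    rw [h]
    nlinarith
  · have h := onCircle_move_eq (hG Real.pi) (onCircle_pi F) (by rw [Real.cos_pi]; exact hc1.ne)
    rw [onCircle_pi, Complex.ofReal_inj, Real.cos_pi] at h
    rw [h]
    refine (convex_bounds ⟨hrl, hru⟩ hneg ?_ ?_).1
    · exact div_nonneg_of_nonpos (by linarith) (by linarith)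
    · rw [div_le_one_of_neg] <;> linarith
  · obtain ⟨hb1, hbd, v, hv, hvl, hvu⟩ := hm b hb
    have hcos : Real.cos (Real.arccos b) = b := Real.cos_arccos hb1.le (by linarith)
    have h := onCircle_move_eq (hG (Real.arccos b)) hv (by rw [hcos]; linarith)
    rw [hcos] at h
    -- Here b ≤ d < c matters: moving the largest zero to the next one makes the new value a convex
    -- combination of r and v.
    have hκ : 0 ≤ (b - d) / (b - c) := div_nonneg_of_nonpos (by linarith) (by linarith)
    have hκ' : (b - d) / (b - c) ≤ 1 := by rw [div_le_one_of_neg] <;> linarith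
    have hb := convex_bounds (u := 1) ⟨hrl, hru⟩ hvl hκ hκ'
    exact ⟨_, h, hb.1, hb.2 hvu⟩
  · refine im_mul_nonneg_of_move hc1 hc' hG ?_ hS
    exact continuous_multiset_prod _ fun b _ => by fun_prop

/-- All sign changes of the imaginary part can be removed. -/
lemma exists_reduce {N : ℕ} {ρ ε : ℝ} (n : ℕ) : ∀ (m : Multiset ℝ), m.card = n → ∀ (F : ℝ[X]),
    F.natDegree ≤ N → F.coeff 0 = 0 → 1 ≤ F.eval 1 → -ρ ≤ F.eval (-1) →
    (∀ b ∈ m, -1 < b ∧ b < 1 ∧ ∃ r : ℝ, onCircle F (Real.arccos b) = r ∧ -ρ ≤ r ∧ r ≤ 1) →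
    (∀ t, 0 ≤ ε * ((onCircle F t).im * Real.sin t * (m.map fun b => Real.cos t - b).prod)) →
    ∃ G : ℝ[X], G.natDegree ≤ N ∧ G.coeff 0 = 0 ∧ 1 ≤ G.eval 1 ∧ -ρ ≤ G.eval (-1) ∧
      ∀ t, 0 ≤ ε * ((onCircle G t).im * Real.sin t) := by
  induction n using Nat.strong_induction_on with
  | _ n ih =>
  intro m hcard F hF h0 h1 hneg hm hS
  rcases eq_or_ne m 0 with rfl | hm0
  · exact ⟨F, hF, h0, h1, hneg, by simpa using hS⟩
  obtain ⟨c, hcm, hcmax⟩ := m.exists_max_image id hm0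
  obtain ⟨m', rfl⟩ := Multiset.exists_cons_of_mem hcm
  obtain ⟨hc1, hc1', hcr⟩ := hm c hcm
  rcases eq_or_ne m' 0 with rfl | hm'0
  -- A lone sign change is pushed to d = -1, where cos t - d never changes sign.
  · have hS' : ∀ t, 0 ≤ ε * ((onCircle F t).im * Real.sin t * ((Real.cos t - c) *
        ((Real.cos t - (-1)) * ((0 : Multiset ℝ).map fun b => Real.cos t - b).prod))) := by
      intro t
      have h := hS t
      have hcos := Real.neg_one_le_cos t
      simp only [Multiset.map_cons, Multiset.prod_cons, Multiset.map_zero, Multiset.prod_zero,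
        mul_one] at h ⊢
      have := mul_nonneg h (by linarith : 0 ≤ Real.cos t - (-1))
      linarith
    obtain ⟨G, hGd, hG0, hG1, hGn, -, hGS⟩ :=
      exists_reduce_step hF h0 h1 hneg le_rfl hc1 hc1' hcr (by simp) hS'
    exact ⟨G, hGd, hG0, hG1, hGn, by simpa using hGS⟩
  obtain ⟨d, hdm, hdmax⟩ := m'.exists_max_image id hm'0
  obtain ⟨m, rfl⟩ := Multiset.exists_cons_of_mem hdm
  obtain ⟨hd1, -, -⟩ := hm d (by simp)
  have hdc : d ≤ c := hcmax d (by simp)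
  simp only [Multiset.card_cons] at hcard
  simp only [Multiset.map_cons, Multiset.prod_cons] at hS
  have hm2 : ∀ b ∈ m, -1 < b ∧ b < 1 ∧
      ∃ r : ℝ, onCircle F (Real.arccos b) = r ∧ -ρ ≤ r ∧ r ≤ 1 := fun b hb =>
    hm b (by simp [hb])
  rcases hdc.eq_or_lt with rfl | hlt
  · refine ih m.card (by omega) m rfl F hF h0 h1 hneg hm2 fun t => ?_
    -- The trivial move, with G = F and d = c, drops the square factor of a repeated zero.
    refine im_mul_nonneg_of_move (F := F) (r := 0) hc1 hc1' (fun t => rfl) ?_ hS t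
    exact continuous_multiset_prod _ fun b _ => by fun_prop
  · obtain ⟨G, hGd, hG0, hG1, hGn, hGm, hGS⟩ :=
      exists_reduce_step hF h0 h1 hneg hd1.le hlt hc1' hcr
        (fun b hb => ⟨(hm2 b hb).1, hdmax b (by simp [hb]), (hm2 b hb).2.2⟩) hS
    exact ih m.card (by omega) m rfl G hGd hG0 hG1 hGn
      (fun b hb => ⟨(hm2 b hb).1, (hm2 b hb).2.1, hGm b hb⟩) hGS

/-! ### Sign changes of the imaginary part -/

/-- sin(jt) = sin t · U_{j-1}(cos t), with U_{-1} = 0 covering j = 0. -/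
lemma exists_im_onCircle_eq (F : ℝ[X]) :
    ∃ s : ℝ[X], ∀ t, (onCircle F t).im = Real.sin t * s.eval (Real.cos t) := by
  refine ⟨∑ j ∈ Finset.range (F.natDegree + 1), C (F.coeff j) * Chebyshev.U ℝ ((j : ℤ) - 1),
    fun t => ?_⟩
  rw [onCircle, aeval_eq_sum_range, Complex.im_sum, eval_finsetSum, Finset.mul_sum]
  refine Finset.sum_congr rfl fun j _ => ?_
  rw [← Complex.exp_nat_mul, ← mul_assoc, Complex.real_smul, Complex.im_ofReal_mul,
    ← Complex.ofReal_natCast, ← Complex.ofReal_mul, Complex.exp_ofReal_mul_I_im, eval_mul, eval_C]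
  have := Chebyshev.U_real_cos t ((j : ℤ) - 1)
  push_cast at this
  rw [sub_add_cancel] at this
  rw [← this]
  ring

/-- Take all roots in (-1, 1) with multiplicity: their factors pair into squares, and the cofactor
has constant sign there. -/
lemma exists_sign_changes (n : ℕ) : ∀ s : ℝ[X], s.natDegree = n →
    ∃ (m : Multiset ℝ) (ε : ℝ), (ε = 1 ∨ ε = -1) ∧ (∀ b ∈ m, -1 < b ∧ b < 1 ∧ s.eval b = 0) ∧
      ∀ x, -1 < x → x < 1 → 0 ≤ ε * (s.eval x * (m.map fun b => x - b).prod) := by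
  induction n using Nat.strong_induction_on with
  | _ n ih =>
  intro s hs
  rcases eq_or_ne s 0 with rfl | hs0
  · exact ⟨0, 1, Or.inl rfl, by simp, by simp⟩
  by_cases h : ∃ c, -1 < c ∧ c < 1 ∧ s.eval c = 0
  · obtain ⟨c, hc, hc', hroot⟩ := h
    obtain ⟨u, rfl⟩ := dvd_iff_isRoot.2 hroot
    have hu : u ≠ 0 := right_ne_zero_of_mul hs0
    rw [natDegree_mul (X_sub_C_ne_zero c) hu, natDegree_X_sub_C] at hs
    obtain ⟨m, ε, hε, hm, hS⟩ := ih u.natDegree (by omega) u rfl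
    refine ⟨c ::ₘ m, ε, hε, fun b hb => ?_, fun x hx hx' => ?_⟩
    · rcases Multiset.mem_cons.1 hb with rfl | hb
      · exact ⟨hc, hc', hroot⟩
      · exact ⟨(hm b hb).1, (hm b hb).2.1, by simp [(hm b hb).2.2]⟩
    · have := mul_nonneg (sq_nonneg (x - c)) (hS x hx hx')
      simp only [eval_mul, eval_sub, eval_X, eval_C, Multiset.map_cons, Multiset.prod_cons]
      linarith
  · push Not at h
    have hne : ∀ x ∈ Set.Ioo (-1 : ℝ) 1, s.eval x ≠ 0 := fun x hx => h x hx.1 hx.2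
    have hzero : (0 : ℝ) ∈ Set.Ioo (-1 : ℝ) 1 := by constructor <;> norm_num
    have hivt : ∀ x ∈ Set.Ioo (-1 : ℝ) 1, 0 < s.eval 0 * s.eval x := by
      intro x hx
      by_contra hcon
      have hcont : ContinuousOn (fun y => s.eval 0 * s.eval y) (Set.Ioo (-1) 1) := by fun_prop
      have hsq : 0 < s.eval 0 * s.eval 0 := mul_self_pos.2 (hne 0 hzero)
      obtain ⟨y, hy, hy0⟩ := isPreconnected_Ioo.intermediate_value hx hzero hcont
        ⟨not_lt.1 hcon, hsq.le⟩
      exact mul_ne_zero (hne 0 hzero) (hne y hy) hy0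
    rcases (hne 0 hzero).lt_or_gt with h0 | h0
    · refine ⟨0, -1, Or.inr rfl, by simp, fun x hx hx' => ?_⟩
      have := hivt x ⟨hx, hx'⟩
      simp
      exact (neg_of_mul_pos_right this h0.le).le
    · refine ⟨0, 1, Or.inl rfl, by simp, fun x hx hx' => ?_⟩
      have := hivt x ⟨hx, hx'⟩
      simp
      exact (pos_of_mul_pos_right this h0.le).le

/-- If the real values on the unit circle of a real polynomial `F` of degree at most `N` with
`F(0) = 0` and `F(1) = 1` lie in `[-ρ, 1]`, then `1 ≤ ρ cot² (π / (2 (N + 1)))`. -/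
theorem one_le_cot_sq_mul {N : ℕ} {ρ : ℝ} {F : ℝ[X]} (hF : F.natDegree ≤ N) (h0 : F.coeff 0 = 0)
    (h1 : F.eval 1 = 1) (hreal : ∀ t v : ℝ, onCircle F t = v → -ρ ≤ v ∧ v ≤ 1) :
    1 ≤ Real.cot (Real.pi / (2 * ((N : ℝ) + 1))) ^ 2 * ρ := by
  obtain ⟨s, hs⟩ := exists_im_onCircle_eq F
  obtain ⟨m, ε, hε, hm, hS⟩ := exists_sign_changes _ s rfl
  obtain ⟨G, hGd, hG0, hG1, hGn, hGS⟩ := exists_reduce (ρ := ρ) (ε := ε) m.card m rfl F hF h0 h1.ge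
    (hreal Real.pi _ (onCircle_pi F)).1 (fun b hb => by
      obtain ⟨hb1, hb2, hb0⟩ := hm b hb
      have hv : onCircle F (Real.arccos b) = ((onCircle F (Real.arccos b)).re : ℝ) := by
        apply Complex.ext
        · simp
        · rw [hs, Real.cos_arccos hb1.le hb2.le, hb0]
          simp
      exact ⟨hb1, hb2, _, hv, hreal _ _ hv⟩) (fun t => by
      rw [hs]
      by_cases hsin : Real.sin t = 0
      · simp [hsin]
      have hsc := Real.sin_sq_add_cos_sq t
      have hpos : 0 < Real.sin t ^ 2 := by positivity
      have hlt : |Real.cos t| < 1 := (sq_lt_one_iff_abs_lt_one _).1 (by linarith)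
      have := mul_nonneg hpos.le (hS _ (abs_lt.1 hlt).1 (abs_lt.1 hlt).2)
      linarith)
  rcases hε with rfl | rfl
  · have := (eval_one_nonneg_and_le_of_typically_real hGd hG0 (by simpa using hGS)).2
    nlinarith [sq_nonneg (Real.cot (Real.pi / (2 * ((N : ℝ) + 1))))]
  -- The sign ε = -1 is impossible: -G would be typically real, yet -G(1) ≤ -1.
  · have := (eval_one_nonneg_and_le_of_typically_real (F := -G) (by simpa using hGd)
      (by simpa using hG0) (by simpa [onCircle] using hGS)).1
    rw [eval_neg] at this
    linarith

/-! ### Schur stability -/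

/-- The generating polynomial `a₁ w + ⋯ + a_N w ^ N`. -/
noncomputable def gen (N : ℕ) (a : Fin N → ℝ) : ℝ[X] :=
  ∑ i : Fin N, C (a i) * X ^ ((i : ℕ) + 1)

lemma natDegree_gen_le (N : ℕ) (a : Fin N → ℝ) : (gen N a).natDegree ≤ N :=
  natDegree_sum_le_of_forall_le _ _ fun i _ =>
    (natDegree_C_mul_X_pow_le _ _).trans i.isLt

lemma coeff_zero_gen (N : ℕ) (a : Fin N → ℝ) : (gen N a).coeff 0 = 0 := by
  simp [gen]

lemma eval_one_gen (N : ℕ) (a : Fin N → ℝ) : (gen N a).eval 1 = ∑ i, a i := by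
  simp [gen, eval_finsetSum]

/-- The substitution λ = w⁻¹ reverses the coefficients of q. -/
lemma aeval_p_one {N : ℕ} (hN : 1 ≤ N) (a : Fin N → ℝ) (μ : ℝ) {w : ℂ} (hw : w ≠ 0) :
    aeval w⁻¹ (p 1 N a μ) = w⁻¹ ^ N * (1 - μ * aeval w (gen N a)) := by
  have hq : aeval w⁻¹ (q N a) = w⁻¹ ^ N * aeval w (gen N a) := by
    simp only [q, gen, map_sum, map_mul, map_pow, aeval_X, aeval_C, Finset.mul_sum]
    refine Finset.sum_congr rfl fun i _ => ?_
    have hsplit : w⁻¹ ^ N = w⁻¹ ^ (N - 1 - (i : ℕ)) * w⁻¹ ^ ((i : ℕ) + 1) := by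
      rw [← pow_add]
      congr 1
      omega
    have hcancel : w⁻¹ ^ ((i : ℕ) + 1) * w ^ ((i : ℕ) + 1) = 1 := by
      rw [← mul_pow, inv_mul_cancel₀ hw, one_pow]
    rw [hsplit]
    linear_combination (-(algebraMap ℝ ℂ (a i)) * w⁻¹ ^ (N - 1 - (i : ℕ))) * hcancel
  simp only [p, mul_one, pow_one, map_sub, map_mul, map_pow, aeval_X, aeval_C, hq,
    Nat.sub_add_cancel hN, Complex.coe_algebraMap]
  ring

lemma not_schurStable_of_onCircle_eq {N : ℕ} (hN : 1 ≤ N) {a : Fin N → ℝ} {t v : ℝ} (hv : v ≠ 0)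
    (h : onCircle (gen N a) t = v) : ¬ SchurStable (p 1 N a v⁻¹) := by
  intro hst
  have hv' : (v : ℂ) ≠ 0 := by exact_mod_cast hv
  have hroot := aeval_p_one hN a v⁻¹ (Complex.exp_ne_zero (t * Complex.I))
  rw [show aeval (Complex.exp (t * Complex.I)) (gen N a) = v from h, Complex.ofReal_inv,
    inv_mul_cancel₀ hv', sub_self, mul_zero] at hroot
  have := hst _ hroot
  rw [norm_inv, Complex.norm_exp_ofReal_mul_I] at this
  norm_num at this

end DFC

theorem theorem2 (N : ℕ) (hN : 1 ≤ N) (μt : ℝ)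
    (hμt : μt < -(Real.cot (Real.pi / (2 * ((N : ℝ) + 1)))) ^ 2) :
    ¬ ∃ a : Fin N → ℝ, ∑ i, a i = 1 ∧
      ∀ μ ∈ Set.Ioo μt 1, DFC.SchurStable (DFC.p 1 N a μ) := by
  rintro ⟨a, hsum, hst⟩
  have hsq := sq_nonneg (Real.cot (Real.pi / (2 * ((N : ℝ) + 1))))
  have hneg : μt < 0 := by linarith
  have hkey := DFC.one_le_cot_sq_mul (ρ := -μt⁻¹) (DFC.natDegree_gen_le N a)
    (DFC.coeff_zero_gen N a) ((DFC.eval_one_gen N a).trans hsum) fun t v hv => by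
      constructor
      · by_contra hlt
        have hlt' : v < μt⁻¹ := by linarith
        have hv0 : v < 0 := hlt'.trans (inv_lt_zero.2 hneg)
        refine DFC.not_schurStable_of_onCircle_eq hN hv0.ne hv (hst _ ⟨?_, ?_⟩)
        · exact (lt_inv_of_neg hv0 hneg).1 hlt'
        · exact (inv_lt_zero.2 hv0).trans one_pos
      · by_contra hgt
        have hv1 : 1 < v := not_le.1 hgt
        have hv0 : 0 < v := one_pos.trans hv1
        exact DFC.not_schurStable_of_onCircle_eq hN hv0.ne' hv
          (hst _ ⟨hneg.trans (inv_pos.2 hv0), inv_lt_one_of_one_lt₀ hv1⟩)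
  have hinv : 0 < -μt⁻¹ := neg_pos.2 (inv_lt_zero.2 hneg)
  have := mul_lt_mul_of_pos_right (by linarith : Real.cot (Real.pi / (2 * ((N : ℝ) + 1))) ^ 2 < -μt)
    hinv
  rw [neg_mul_neg, mul_inv_cancel₀ hneg.ne] at this
  linarith
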